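/- Theorem (approximation stability in $\mathbb{R}^2$). For a nonempty finite set $P\subset\mathbb{R}^2$ and $u\in\mathbb{S}^1$, let $P[u]$ be a point of $P$ maximizing $\langle p,u\rangle$ over $p\in P$, and let $\omega(P,u)=\langle P[u]-P[-u],u\rangle$ be the directional width of $P$ in direction $u$. For $\varepsilon>0$, a nonempty subset $K\subseteq P$ is an $\varepsilon$-kernel of $P$ if $\langle P[u]-K[u],u\rangle\le\varepsilon\,\omega(P,u)$ for all $u\in\mathbb{S}^1$. Let $\kappa(P,\varepsilon)$ denote the minimum size of an $\varepsilon$-kernel of $P$ (so $\kappa(P,\varepsilon)\ge 1$). Then there is an absolute constant $C$ such that for every nonempty finite point set $P\subset\mathbb{R}^2$ and every $\varepsilon>0$, $$\frac{\kappa(P,\varepsilon/2)}{\kappa(P,\varepsilon)}\le C.$$ -/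

import Mathlib

/-- Every nonempty finite set of points has an extreme point in each direction. -/
theorem exists_extremePt {d : ℕ} (P : Finset (EuclideanSpace ℝ (Fin d))) (hP : P.Nonempty)
    (u : EuclideanSpace ℝ (Fin d)) :
    ∃ p ∈ P, ∀ q ∈ P, inner ℝ q u ≤ inner ℝ p u :=
  Finset.exists_max_image P (fun p => inner ℝ p u) hP

/-- The extreme point `P[u]`: a point `p` of `P` maximizing the inner product of `p` and `u`. Ties
are broken arbitrarily; only the inner product of `P[u]` with `u` is ever used, and it does not
depend on the choice. -/
noncomputable def extremePt {d : ℕ} (P : Finset (EuclideanSpace ℝ (Fin d))) (hP : P.Nonempty)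
    (u : EuclideanSpace ℝ (Fin d)) : EuclideanSpace ℝ (Fin d) :=
  Classical.choose (exists_extremePt P hP u)

theorem extremePt_mem {d : ℕ} (P : Finset (EuclideanSpace ℝ (Fin d))) (hP : P.Nonempty)
    (u : EuclideanSpace ℝ (Fin d)) : extremePt P hP u ∈ P :=
  (Classical.choose_spec (exists_extremePt P hP u)).1

theorem inner_le_inner_extremePt {d : ℕ} (P : Finset (EuclideanSpace ℝ (Fin d)))
    (hP : P.Nonempty) (u q : EuclideanSpace ℝ (Fin d)) (hq : q ∈ P) :
    inner ℝ q u ≤ inner ℝ (extremePt P hP u) u :=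
  (Classical.choose_spec (exists_extremePt P hP u)).2 q hq

/-- The directional width of `P` in direction `u`. -/
noncomputable def directionalWidth {d : ℕ} (P : Finset (EuclideanSpace ℝ (Fin d)))
    (hP : P.Nonempty) (u : EuclideanSpace ℝ (Fin d)) : ℝ :=
  inner ℝ (extremePt P hP u - extremePt P hP (-u)) u

/-- `K` is an `ε`-kernel of `P`: a nonempty subset of `P` such that, in every unit direction `u`,
the extreme points of `P` and `K` differ along `u` by at most `ε` times the width of `P`. -/
def IsEpsKernel {d : ℕ} (ε : ℝ) (P K : Finset (EuclideanSpace ℝ (Fin d))) : Prop :=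
  ∃ (hK : K.Nonempty) (hKP : K ⊆ P), ∀ u : EuclideanSpace ℝ (Fin d), ‖u‖ = 1 →
    inner ℝ (extremePt P (hK.mono hKP) u - extremePt K hK u) u
      ≤ ε * directionalWidth P (hK.mono hKP) u

/-- The minimum size of an `ε`-kernel of `P`. -/
noncomputable def kappa {d : ℕ} (P : Finset (EuclideanSpace ℝ (Fin d))) (ε : ℝ) : ℕ :=
  sInf {n : ℕ | ∃ K : Finset (EuclideanSpace ℝ (Fin d)), IsEpsKernel ε P K ∧ K.card = n}

/-! An `ε`-kernel `K` is refined to an `ε / 2`-kernel by replacing each of its points by boundedly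
many points of `P`. If `P` is not collinear, take two differences of points of `P` spanning maximal
area. Maximality makes the width of `P` equal to 1 along both vectors `e, f` of the dual basis, and
between 1/2 and 1 on the segments joining `±e` to `±f`. On the part of such a segment where `v` is
extreme in `K`, the functions `⟨p - v, ·⟩` are affine with upper envelope in `[0, ε]`. Four layers
of height `ε / 4`, two points per layer (`exists_approx_envelope`), give 8 points per `v`; four
segments give the factor 32. Collinear sets are handled by a farthest pair. -/

/-- For `ε ≥ 0`, an `ε`-kernel can be described without choosing extreme points, and the unit
directions can be replaced by arbitrary directions in which the inequality is homogeneous. -/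
theorem isEpsKernel_iff {d : ℕ} {ε : ℝ} (hε : 0 ≤ ε) (P K : Finset (EuclideanSpace ℝ (Fin d))) :
    IsEpsKernel ε P K ↔ K.Nonempty ∧ K ⊆ P ∧ ∀ u : EuclideanSpace ℝ (Fin d), u ≠ 0 →
      ∀ p ∈ P, ∃ k ∈ K, ∃ q ∈ P, ∃ r ∈ P, inner ℝ (p - k) u ≤ ε * inner ℝ (q - r) u := by
  constructor
  · rintro ⟨hK, hKP, h⟩
    refine ⟨hK, hKP, fun u hu p hp => ?_⟩
    have hP := hK.mono hKP
    have hn : 0 < ‖u‖ := norm_pos_iff.mpr hu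
    set w : EuclideanSpace ℝ (Fin d) := ‖u‖⁻¹ • u with hw
    have hw1 : ‖w‖ = 1 := by rw [hw, norm_smul, norm_inv, norm_norm, inv_mul_cancel₀ hn.ne']
    have huw : u = ‖u‖ • w := by rw [hw, smul_smul, mul_inv_cancel₀ hn.ne', one_smul]
    refine ⟨extremePt K hK w, extremePt_mem _ _ _, extremePt P hP w, extremePt_mem _ _ _,
      extremePt P hP (-w), extremePt_mem _ _ _, ?_⟩
    have h1 := h w hw1
    have h2 := inner_le_inner_extremePt P hP w p hp
    unfold directionalWidth at h1
    have h3 : inner ℝ (p - extremePt K hK w) w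
        ≤ ε * inner ℝ (extremePt P hP w - extremePt P hP (-w)) w := by
      rw [inner_sub_left] at h1 ⊢
      linarith
    calc inner ℝ (p - extremePt K hK w) u = ‖u‖ * inner ℝ (p - extremePt K hK w) w := by
          conv_lhs => rw [huw, real_inner_smul_right]
      _ ≤ ‖u‖ * (ε * inner ℝ (extremePt P hP w - extremePt P hP (-w)) w) :=
          mul_le_mul_of_nonneg_left h3 hn.le
      _ = ε * inner ℝ (extremePt P hP w - extremePt P hP (-w)) u := by
          conv_rhs => rw [huw, real_inner_smul_right]
          ring
  · rintro ⟨hK, hKP, h⟩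
    refine ⟨hK, hKP, fun u hu => ?_⟩
    have hP := hK.mono hKP
    obtain ⟨k, hk, q, hq, r, hr, hle⟩ := h u (by rintro rfl; simp at hu) _ (extremePt_mem P hP u)
    have h1 := inner_le_inner_extremePt K hK u k hk
    have h2 := inner_le_inner_extremePt P hP u q hq
    have h3 := inner_le_inner_extremePt P hP (-u) r hr
    rw [inner_neg_right, inner_neg_right] at h3
    unfold directionalWidth
    have h4 : ε * inner ℝ (q - r) u ≤ ε * inner ℝ (extremePt P hP u - extremePt P hP (-u)) u := by
      apply mul_le_mul_of_nonneg_left _ hε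
      rw [inner_sub_left, inner_sub_left]
      linarith
    rw [inner_sub_left] at hle ⊢
    linarith

theorem isEpsKernel_self {d : ℕ} {ε : ℝ} (hε : 0 ≤ ε) {P : Finset (EuclideanSpace ℝ (Fin d))}
    (hP : P.Nonempty) : IsEpsKernel ε P P :=
  (isEpsKernel_iff hε P P).2 ⟨hP, subset_rfl, fun _ _ p hp => ⟨p, hp, p, hp, p, hp, by simp⟩⟩

theorem IsEpsKernel.kappa_le {d : ℕ} {ε : ℝ} {P K : Finset (EuclideanSpace ℝ (Fin d))}
    (h : IsEpsKernel ε P K) : kappa P ε ≤ K.card :=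
  Nat.sInf_le ⟨K, h, rfl⟩

theorem exists_isEpsKernel_card_eq_kappa {d : ℕ} {ε : ℝ} (hε : 0 ≤ ε)
    {P : Finset (EuclideanSpace ℝ (Fin d))} (hP : P.Nonempty) :
    ∃ K, IsEpsKernel ε P K ∧ K.card = kappa P ε :=
  Nat.sInf_mem (s := {n : ℕ | ∃ K, IsEpsKernel ε P K ∧ K.card = n})
    ⟨_, P, isEpsKernel_self hε hP, rfl⟩

theorem kappa_pos {d : ℕ} {ε : ℝ} (hε : 0 ≤ ε) {P : Finset (EuclideanSpace ℝ (Fin d))}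
    (hP : P.Nonempty) : 0 < kappa P ε := by
  obtain ⟨K, ⟨hK, -⟩, hc⟩ := exists_isEpsKernel_card_eq_kappa hε hP
  exact hc ▸ hK.card_pos

/-! ### Approximating upper envelopes of affine functions -/

/-- If the upper envelope of a finite family of affine functions oscillates by at most `δ` on a
set `S`, then one function approximates the envelope up to `δ` at all points of `S` where it is
attained with nonnegative slope. -/
theorem exists_approx_envelope_of_slope_nonneg {α : Type*} (P : Finset α) (a b : α → ℝ) {δ : ℝ}
    (hδ : 0 ≤ δ) (S : Set ℝ)
    (hS : ∀ s ∈ S, ∀ t ∈ S, ∀ p ∈ P, ∃ q ∈ P, a p + b p * t ≤ a q + b q * s + δ) :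
    ∃ Q ⊆ P, Q.card ≤ 1 ∧ ∀ t ∈ S,
      (∃ p ∈ P, 0 ≤ b p ∧ ∀ r ∈ P, a r + b r * t ≤ a p + b p * t) →
      ∀ p ∈ P, ∃ q ∈ Q, a p + b p * t ≤ a q + b q * t + δ := by
  classical
  set A := P.filter fun p => 0 ≤ b p ∧ ∃ t ∈ S, ∀ r ∈ P, a r + b r * t ≤ a p + b p * t with hA
  rcases A.eq_empty_or_nonempty with hE | hne
  · refine ⟨∅, by simp, by simp, ?_⟩
    rintro t ht ⟨p, hp, hb, hr⟩
    have : p ∈ A := Finset.mem_filter.2 ⟨hp, hb, t, ht, hr⟩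
    simp [hE] at this
  · obtain ⟨q, hqA, hq⟩ := A.exists_min_image b hne
    obtain ⟨hqP, hqb, s, hs, hqs⟩ := Finset.mem_filter.1 hqA
    refine ⟨{q}, by simpa using hqP, by simp, ?_⟩
    rintro t ht ⟨m, hm, hmb, hmt⟩ p hp
    refine ⟨q, by simp, ?_⟩
    rcases le_total s t with hst | hts
    · obtain ⟨r, hr, h⟩ := hS s hs t ht p hp
      have := hqs r hr
      nlinarith [mul_nonneg hqb (sub_nonneg.2 hst)]
    · have h1 := hq m (Finset.mem_filter.2 ⟨hm, hmb, t, ht, hmt⟩)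
      have h2 := hqs m hm
      have h3 := hmt p hp
      nlinarith [mul_nonneg (sub_nonneg.2 h1) (sub_nonneg.2 hts)]

/-- One function serves the maximizers of nonnegative slope and, after reflecting `t ↦ -t`, another
serves those of nonpositive slope. -/
theorem exists_approx_envelope_of_oscillation {α : Type*} (P : Finset α) (a b : α → ℝ) {δ : ℝ}
    (hδ : 0 ≤ δ) (S : Set ℝ)
    (hS : ∀ s ∈ S, ∀ t ∈ S, ∀ p ∈ P, ∃ q ∈ P, a p + b p * t ≤ a q + b q * s + δ) :
    ∃ Q ⊆ P, Q.card ≤ 2 ∧ ∀ t ∈ S, ∀ p ∈ P, ∃ q ∈ Q, a p + b p * t ≤ a q + b q * t + δ := by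
  classical
  obtain ⟨Q₁, hQ₁, hc₁, h₁⟩ := exists_approx_envelope_of_slope_nonneg P a b hδ S hS
  obtain ⟨Q₂, hQ₂, hc₂, h₂⟩ := exists_approx_envelope_of_slope_nonneg P a (fun p => -b p) hδ
    (Neg.neg ⁻¹' S) (fun s hs t ht p hp => by simpa using hS (-s) hs (-t) ht p hp)
  refine ⟨Q₁ ∪ Q₂, Finset.union_subset hQ₁ hQ₂, (Finset.card_union_le _ _).trans (by omega), ?_⟩
  intro t ht p hp
  obtain ⟨m, hm, hmax⟩ := P.exists_max_image (fun p => a p + b p * t) ⟨p, hp⟩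
  rcases le_total 0 (b m) with hb | hb
  · obtain ⟨q, hq, h⟩ := h₁ t ht ⟨m, hm, hb, hmax⟩ p hp
    exact ⟨q, Finset.mem_union_left _ hq, h⟩
  · obtain ⟨q, hq, h⟩ := h₂ (-t) (by simpa using ht)
      ⟨m, hm, by simpa using hb, by simpa using hmax⟩ p hp
    exact ⟨q, Finset.mem_union_right _ hq, by simpa using h⟩

/-- The upper envelope of a finite family of affine functions can be approximated up to `δ`, on a
set where it takes values in `[0, (n + 1) * δ]`, by `2 * (n + 1)` functions of the family. -/
theorem exists_approx_envelope {α : Type*} (P : Finset α) (a b : α → ℝ) {δ : ℝ} (hδ : 0 ≤ δ)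
    (n : ℕ) (I : Set ℝ) (h0 : ∀ t ∈ I, ∃ p ∈ P, 0 ≤ a p + b p * t)
    (hn : ∀ t ∈ I, ∀ p ∈ P, a p + b p * t ≤ (n + 1 : ℕ) * δ) :
    ∃ Q ⊆ P, Q.card ≤ 2 * (n + 1) ∧
      ∀ t ∈ I, ∀ p ∈ P, ∃ q ∈ Q, a p + b p * t ≤ a q + b q * t + δ := by
  classical
  induction n generalizing I with
  | zero =>
    refine exists_approx_envelope_of_oscillation P a b hδ I fun s hs t ht p hp => ?_
    obtain ⟨q, hq, h⟩ := h0 s hs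
    have := hn t ht p hp
    push_cast at this
    exact ⟨q, hq, by linarith⟩
  | succ n ih =>
    obtain ⟨Q₁, hQ₁, hc₁, h₁⟩ := ih {t ∈ I | ∀ p ∈ P, a p + b p * t ≤ (n + 1 : ℕ) * δ}
      (fun t ht => h0 t ht.1) (fun t ht => ht.2)
    -- The top layer: the envelope lies in `[(n + 1) * δ, (n + 2) * δ]`, so it oscillates by at most
    -- `δ`.
    obtain ⟨Q₂, hQ₂, hc₂, h₂⟩ := exists_approx_envelope_of_oscillation P a b hδ
      {t ∈ I | ∃ p ∈ P, (n + 1 : ℕ) * δ ≤ a p + b p * t} (by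
        rintro s ⟨-, q, hq, hqs⟩ t ⟨ht, -⟩ p hp
        have := hn t ht p hp
        push_cast at this hqs
        exact ⟨q, hq, by linarith⟩)
    refine ⟨Q₁ ∪ Q₂, Finset.union_subset hQ₁ hQ₂, (Finset.card_union_le _ _).trans (by omega), ?_⟩
    intro t ht p hp
    by_cases hle : ∀ p ∈ P, a p + b p * t ≤ (n + 1 : ℕ) * δ
    · obtain ⟨q, hq, h⟩ := h₁ t ⟨ht, hle⟩ p hp
      exact ⟨q, Finset.mem_union_left _ hq, h⟩
    · push Not at hle
      obtain ⟨r, hr, hlt⟩ := hle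
      obtain ⟨q, hq, h⟩ := h₂ t ⟨ht, r, hr, hlt.le⟩ p hp
      exact ⟨q, Finset.mem_union_right _ hq, h⟩

/-! ### Refining a kernel cone by cone -/

/-- Refinement of an `ε`-kernel to an `ε / 2`-kernel for the directions in the convex cone spanned
by `e` and `f`, when the width is between `1 / 2` and `1` on the segment from `e` to `f`. -/
theorem exists_refinement_on_cone {d : ℕ} {ε : ℝ} (hε : 0 < ε)
    (P K : Finset (EuclideanSpace ℝ (Fin d))) (hK : K.Nonempty) (hKP : K ⊆ P)
    (e f : EuclideanSpace ℝ (Fin d))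
    (hker : ∀ s t : ℝ, 0 ≤ s → 0 ≤ t → s + t = 1 → ∀ p ∈ P, ∃ k ∈ K, ∃ q ∈ P, ∃ r ∈ P,
      inner ℝ (p - k) (s • e + t • f) ≤ ε * inner ℝ (q - r) (s • e + t • f))
    (he : ∀ p ∈ P, ∀ q ∈ P, inner ℝ (p - q) e ≤ 1) (hf : ∀ p ∈ P, ∀ q ∈ P, inner ℝ (p - q) f ≤ 1)
    (hex : ∃ p ∈ P, ∃ q ∈ P, inner ℝ (p - q) e = 1 ∧ inner ℝ (p - q) f = 0)
    (hfx : ∃ p ∈ P, ∃ q ∈ P, inner ℝ (p - q) e = 0 ∧ inner ℝ (p - q) f = 1) :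
    ∃ Q ⊆ P, Q.card ≤ 8 * K.card ∧ ∀ s t : ℝ, 0 ≤ s → 0 ≤ t → 0 < s + t →
      ∀ p ∈ P, ∃ k ∈ Q, ∃ q ∈ P, ∃ r ∈ P,
        inner ℝ (p - k) (s • e + t • f) ≤ ε / 2 * inner ℝ (q - r) (s • e + t • f) := by
  classical
  have key : ∀ v ∈ K, ∃ Q ⊆ P, Q.card ≤ 8 ∧ ∀ t ∈ {t : ℝ | 0 ≤ t ∧ t ≤ 1 ∧
      ∀ w ∈ K, inner ℝ w ((1 - t) • e + t • f) ≤ inner ℝ v ((1 - t) • e + t • f)},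
      ∀ p ∈ P, ∃ q ∈ Q, inner ℝ (p - v) e + (inner ℝ (p - v) f - inner ℝ (p - v) e) * t
        ≤ inner ℝ (q - v) e + (inner ℝ (q - v) f - inner ℝ (q - v) e) * t + ε / 4 := by
    intro v hv
    refine exists_approx_envelope P (fun p => inner ℝ (p - v) e)
      -- With `n = 3` and `δ = ε / 4`, the bound `(n + 1) * δ` is `ε` and the count `2 * (n + 1)` is
      -- 8.
      (fun p => inner ℝ (p - v) f - inner ℝ (p - v) e) (by positivity) 3 _ ?_ ?_
    · exact fun t _ => ⟨v, hKP hv, by simp⟩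
    · rintro t ⟨ht0, ht1, ht⟩ p hp
      obtain ⟨k, hk, q, hq, r, hr, h⟩ := hker (1 - t) t (by linarith) ht0 (by ring) p hp
      have h1 := ht k hk
      have h2 := he q hq r hr
      have h3 := hf q hq r hr
      simp only [inner_add_right, real_inner_smul_right, inner_sub_left] at *
      have h4 : ε * ((1 - t) * (inner ℝ q e - inner ℝ r e) + t * (inner ℝ q f - inner ℝ r f))
          ≤ ε * 1 := by
        apply mul_le_mul_of_nonneg_left _ hε.le
        nlinarith
      push_cast
      linarith
  choose! Q hQP hQc hQ using key
  refine ⟨K.biUnion Q, Finset.biUnion_subset.2 hQP, ?_, ?_⟩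
  · rw [mul_comm]
    exact Finset.card_biUnion_le_card_mul _ _ _ hQc
  intro s t hs ht hst p hp
  set τ := t / (s + t) with hτ
  have hτ0 : 0 ≤ τ := by positivity
  have hτ1 : τ ≤ 1 := by rw [hτ, div_le_one hst]; linarith
  have htτ : t = (s + t) * τ := by rw [hτ]; field_simp
  have hsτ : s = (s + t) * (1 - τ) := by linarith
  obtain ⟨v, hv, hmax⟩ := K.exists_max_image (fun w => inner ℝ w ((1 - τ) • e + τ • f)) hK
  obtain ⟨k, hk, h⟩ := hQ v hv τ ⟨hτ0, hτ1, hmax⟩ p hp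
  refine ⟨k, Finset.mem_biUnion.2 ⟨v, hv, hk⟩, ?_⟩
  have hsc : ∀ z : EuclideanSpace ℝ (Fin d), inner ℝ z (s • e + t • f)
      = (s + t) * ((1 - τ) * inner ℝ z e + τ * inner ℝ z f) := by
    intro z
    rw [inner_add_right, real_inner_smul_right, real_inner_smul_right]
    linear_combination inner ℝ z f * htτ + inner ℝ z e * hsτ
  have hpk : (1 - τ) * inner ℝ (p - k) e + τ * inner ℝ (p - k) f ≤ ε / 4 := by
    simp only [inner_sub_left] at h ⊢
    linarith
  -- Width at least 1/2 turns the absolute error `ε / 4` into the relative error `ε / 2`.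
  obtain ⟨q, hq, r, hr, hqr⟩ : ∃ q ∈ P, ∃ r ∈ P,
      1 / 2 ≤ (1 - τ) * inner ℝ (q - r) e + τ * inner ℝ (q - r) f := by
    rcases le_total τ (1 / 2) with hτ2 | hτ2
    · obtain ⟨q, hq, r, hr, h1, h2⟩ := hex
      exact ⟨q, hq, r, hr, by rw [h1, h2]; linarith⟩
    · obtain ⟨q, hq, r, hr, h1, h2⟩ := hfx
      exact ⟨q, hq, r, hr, by rw [h1, h2]; linarith⟩
  refine ⟨q, hq, r, hr, ?_⟩
  rw [hsc, hsc, mul_left_comm]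
  apply mul_le_mul_of_nonneg_left _ hst.le
  nlinarith

/-- If the widths in the directions of a basis `e, f` are normalized by a pair of differences of
points of `P` dual to the basis, an `ε`-kernel can be refined to an `ε / 2`-kernel. -/
theorem exists_refinement_of_dual_pair {d : ℕ} {ε : ℝ} (hε : 0 < ε)
    (P K : Finset (EuclideanSpace ℝ (Fin d))) (hK : IsEpsKernel ε P K)
    (e f : EuclideanSpace ℝ (Fin d)) (hspan : ∀ u, ∃ s t : ℝ, u = s • e + t • f)
    (he : ∀ p ∈ P, ∀ q ∈ P, inner ℝ (p - q) e ≤ 1) (hf : ∀ p ∈ P, ∀ q ∈ P, inner ℝ (p - q) f ≤ 1)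
    (hex : ∃ p ∈ P, ∃ q ∈ P, inner ℝ (p - q) e = 1 ∧ inner ℝ (p - q) f = 0)
    (hfx : ∃ p ∈ P, ∃ q ∈ P, inner ℝ (p - q) e = 0 ∧ inner ℝ (p - q) f = 1) :
    ∃ Q, IsEpsKernel (ε / 2) P Q ∧ Q.card ≤ 32 * K.card := by
  classical
  obtain ⟨hKne, hKP, hker⟩ := (isEpsKernel_iff hε.le P K).1 hK
  have hneg : ∀ g : EuclideanSpace ℝ (Fin d), (∀ p ∈ P, ∀ q ∈ P, inner ℝ (p - q) g ≤ 1) →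
      ∀ p ∈ P, ∀ q ∈ P, inner ℝ (p - q) (-g) ≤ 1 := by
    intro g hg p hp q hq
    have := hg q hq p hp
    rwa [← neg_sub, inner_neg_left, ← inner_neg_right] at this
  have hker' : ∀ e' f' : EuclideanSpace ℝ (Fin d),
      (∃ p ∈ P, ∃ q ∈ P, inner ℝ (p - q) e' = 1 ∧ inner ℝ (p - q) f' = 0) →
      (∃ p ∈ P, ∃ q ∈ P, inner ℝ (p - q) e' = 0 ∧ inner ℝ (p - q) f' = 1) →
      ∀ s t : ℝ, 0 ≤ s → 0 ≤ t → s + t = 1 → ∀ p ∈ P, ∃ k ∈ K, ∃ q ∈ P, ∃ r ∈ P,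
      inner ℝ (p - k) (s • e' + t • f') ≤ ε * inner ℝ (q - r) (s • e' + t • f') := by
    rintro e' f' ⟨p₁, -, q₁, -, h₁, h₁'⟩ ⟨p₂, -, q₂, -, h₂, h₂'⟩ s t hs ht hst
    refine hker _ fun h0 => ?_
    have hs0 : inner ℝ (p₁ - q₁) (s • e' + t • f') = s := by
      rw [inner_add_right, real_inner_smul_right, real_inner_smul_right, h₁, h₁']; ring
    have ht0 : inner ℝ (p₂ - q₂) (s • e' + t • f') = t := by
      rw [inner_add_right, real_inner_smul_right, real_inner_smul_right, h₂, h₂']; ring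
    rw [h0, inner_zero_right] at hs0 ht0
    linarith
  obtain ⟨p₁, hp₁, q₁, hq₁, h₁, h₁'⟩ := hex
  obtain ⟨p₂, hp₂, q₂, hq₂, h₂, h₂'⟩ := hfx
  have flip : ∀ p q : EuclideanSpace ℝ (Fin d), ∀ g, inner ℝ (p - q) g = -inner ℝ (q - p) g := by
    intro p q g
    rw [← neg_sub, inner_neg_left]
  have A₁ : ∃ p ∈ P, ∃ q ∈ P, inner ℝ (p - q) e = 1 ∧ inner ℝ (p - q) f = 0 :=
    ⟨p₁, hp₁, q₁, hq₁, h₁, h₁'⟩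
  have B₁ : ∃ p ∈ P, ∃ q ∈ P, inner ℝ (p - q) e = 0 ∧ inner ℝ (p - q) f = 1 :=
    ⟨p₂, hp₂, q₂, hq₂, h₂, h₂'⟩
  have A₂ : ∃ p ∈ P, ∃ q ∈ P, inner ℝ (p - q) e = 1 ∧ inner ℝ (p - q) (-f) = 0 :=
    ⟨p₁, hp₁, q₁, hq₁, h₁, by simp [inner_neg_right, h₁']⟩
  have B₂ : ∃ p ∈ P, ∃ q ∈ P, inner ℝ (p - q) e = 0 ∧ inner ℝ (p - q) (-f) = 1 :=
    ⟨q₂, hq₂, p₂, hp₂, by rw [flip, h₂, neg_zero], by rw [flip, inner_neg_right, h₂', neg_neg]⟩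
  have A₃ : ∃ p ∈ P, ∃ q ∈ P, inner ℝ (p - q) (-e) = 1 ∧ inner ℝ (p - q) f = 0 :=
    ⟨q₁, hq₁, p₁, hp₁, by rw [flip, inner_neg_right, h₁, neg_neg], by rw [flip, h₁', neg_zero]⟩
  have B₃ : ∃ p ∈ P, ∃ q ∈ P, inner ℝ (p - q) (-e) = 0 ∧ inner ℝ (p - q) f = 1 :=
    ⟨p₂, hp₂, q₂, hq₂, by simp [inner_neg_right, h₂], h₂'⟩
  have A₄ : ∃ p ∈ P, ∃ q ∈ P, inner ℝ (p - q) (-e) = 1 ∧ inner ℝ (p - q) (-f) = 0 :=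
    ⟨q₁, hq₁, p₁, hp₁, by rw [flip, inner_neg_right, h₁, neg_neg],
      by rw [flip, inner_neg_right, h₁', neg_zero, neg_zero]⟩
  have B₄ : ∃ p ∈ P, ∃ q ∈ P, inner ℝ (p - q) (-e) = 0 ∧ inner ℝ (p - q) (-f) = 1 :=
    ⟨q₂, hq₂, p₂, hp₂, by rw [flip, inner_neg_right, h₂, neg_zero, neg_zero],
      by rw [flip, inner_neg_right, h₂', neg_neg]⟩
  obtain ⟨Q₁, hQ₁, hc₁, H₁⟩ := exists_refinement_on_cone hε P K hKne hKP e f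
    (hker' _ _ A₁ B₁) he hf A₁ B₁
  obtain ⟨Q₂, hQ₂, hc₂, H₂⟩ := exists_refinement_on_cone hε P K hKne hKP e (-f)
    (hker' _ _ A₂ B₂) he (hneg f hf) A₂ B₂
  obtain ⟨Q₃, hQ₃, hc₃, H₃⟩ := exists_refinement_on_cone hε P K hKne hKP (-e) f
    (hker' _ _ A₃ B₃) (hneg e he) hf A₃ B₃
  obtain ⟨Q₄, hQ₄, hc₄, H₄⟩ := exists_refinement_on_cone hε P K hKne hKP (-e) (-f)
    (hker' _ _ A₄ B₄) (hneg e he) (hneg f hf) A₄ B₄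
  refine ⟨(Q₁ ∪ Q₂) ∪ (Q₃ ∪ Q₄), (isEpsKernel_iff (by positivity) _ _).2 ⟨?_, ?_, ?_⟩, ?_⟩
  · obtain ⟨k, hk, -⟩ := H₁ 1 0 zero_le_one le_rfl (by norm_num) p₁ hp₁
    exact ⟨k, by simp [hk]⟩
  · exact Finset.union_subset (Finset.union_subset hQ₁ hQ₂) (Finset.union_subset hQ₃ hQ₄)
  · intro u hu p hp
    obtain ⟨s, t, rfl⟩ := hspan u
    have hst : 0 < |s| + |t| := by
      by_contra hcon
      have hs := abs_nonneg s
      have ht := abs_nonneg t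
      have hs0 : s = 0 := abs_eq_zero.1 (by linarith)
      have ht0 : t = 0 := abs_eq_zero.1 (by linarith)
      exact hu (by rw [hs0, ht0, zero_smul, zero_smul, add_zero])
    rcases le_total 0 s with hs | hs <;> rcases le_total 0 t with ht | ht
    · rw [abs_of_nonneg hs, abs_of_nonneg ht] at hst
      obtain ⟨k, hk, h⟩ := H₁ s t hs ht hst p hp
      exact ⟨k, by simp [hk], h⟩
    · rw [abs_of_nonneg hs, abs_of_nonpos ht] at hst
      obtain ⟨k, hk, h⟩ := H₂ s (-t) hs (by linarith) hst p hp
      rw [neg_smul_neg] at h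
      exact ⟨k, by simp [hk], h⟩
    · rw [abs_of_nonpos hs, abs_of_nonneg ht] at hst
      obtain ⟨k, hk, h⟩ := H₃ (-s) t (by linarith) ht hst p hp
      rw [neg_smul_neg] at h
      exact ⟨k, by simp [hk], h⟩
    · rw [abs_of_nonpos hs, abs_of_nonpos ht] at hst
      obtain ⟨k, hk, h⟩ := H₄ (-s) (-t) (by linarith) (by linarith) hst p hp
      rw [neg_smul_neg, neg_smul_neg] at h
      exact ⟨k, by simp [hk], h⟩
  · have h1 := Finset.card_union_le Q₁ Q₂
    have h2 := Finset.card_union_le Q₃ Q₄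
    have h3 := Finset.card_union_le (Q₁ ∪ Q₂) (Q₃ ∪ Q₄)
    omega

/-! ### Collinear and noncollinear planar sets -/

theorem real_inner_fin_two (x y : EuclideanSpace ℝ (Fin 2)) :
    inner ℝ x y = x 0 * y 0 + x 1 * y 1 := by
  simp [PiLp.inner_apply, Fin.sum_univ_two, mul_comm]

/-- The signed area spanned by two vectors of the plane. -/
def planarDet (x y : EuclideanSpace ℝ (Fin 2)) : ℝ := x 0 * y 1 - x 1 * y 0

/-- A collinear set has an `ε`-kernel of at most two points for every `ε ≥ 0`. -/
theorem exists_isEpsKernel_card_le_two {ε : ℝ} (hε : 0 ≤ ε)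
    (P : Finset (EuclideanSpace ℝ (Fin 2))) (hP : P.Nonempty)
    (hcol : ∀ p ∈ P, ∀ q ∈ P, ∀ r ∈ P, planarDet (r - p) (q - p) = 0) :
    ∃ K, IsEpsKernel ε P K ∧ K.card ≤ 2 := by
  classical
  -- For a farthest pair `p, q`, every other point lies on the segment between them, so one of the
  -- two is at least as extreme.
  obtain ⟨⟨p, q⟩, hpq, hmax⟩ := (P ×ˢ P).exists_max_image
    (fun z => inner ℝ (z.2 - z.1) (z.2 - z.1)) (hP.product hP)
  obtain ⟨hp, hq⟩ := Finset.mem_product.1 hpq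
  refine ⟨{p, q}, (isEpsKernel_iff hε _ _).2 ⟨by simp, ?_, ?_⟩, Finset.card_le_two⟩
  · intro z hz
    simp only [Finset.mem_insert, Finset.mem_singleton] at hz
    rcases hz with rfl | rfl <;> assumption
  intro u _ r hr
  suffices h : inner ℝ (r - p) u ≤ 0 ∨ inner ℝ (r - q) u ≤ 0 by
    rcases h with h | h
    · exact ⟨p, by simp, p, hp, p, hp, by simpa using h⟩
    · exact ⟨q, by simp, p, hp, p, hp, by simpa using h⟩
  have h1 := hmax (p, r) (Finset.mem_product.2 ⟨hp, hr⟩)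
  have h2 := hmax (q, r) (Finset.mem_product.2 ⟨hq, hr⟩)
  have h3 := hcol p hp q hq r hr
  have hrq : r - q = (r - p) - (q - p) := by abel
  rw [hrq] at h2 ⊢
  generalize r - p = w at *
  generalize q - p = v at *
  simp only [planarDet, real_inner_fin_two, PiLp.sub_apply] at h1 h2 h3 ⊢
  rcases (add_nonneg (mul_self_nonneg (v 0)) (mul_self_nonneg (v 1))).eq_or_lt with hN | hN
  · have hw0 : w 0 = 0 := by nlinarith [mul_self_nonneg (w 0), mul_self_nonneg (w 1)]
    have hw1 : w 1 = 0 := by nlinarith [mul_self_nonneg (w 0), mul_self_nonneg (w 1)]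
    left
    rw [hw0, hw1]
    simp
  have hc0 : 0 ≤ w 0 * v 0 + w 1 * v 1 := by
    nlinarith [mul_self_nonneg (w 0), mul_self_nonneg (w 1)]
  have hcN : w 0 * v 0 + w 1 * v 1 ≤ v 0 * v 0 + v 1 * v 1 := by
    nlinarith [mul_self_nonneg (w 0 - v 0), mul_self_nonneg (w 1 - v 1)]
  have hw : (v 0 * v 0 + v 1 * v 1) * (w 0 * u 0 + w 1 * u 1)
      = (w 0 * v 0 + w 1 * v 1) * (v 0 * u 0 + v 1 * u 1) := by
    linear_combination (v 1 * u 0 - v 0 * u 1) * h3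
  rcases le_total (v 0 * u 0 + v 1 * u 1) 0 with hu | hu
  · left
    refine nonpos_of_mul_nonpos_right ?_ hN
    rw [hw]
    exact mul_nonpos_of_nonneg_of_nonpos hc0 hu
  · right
    refine nonpos_of_mul_nonpos_right ?_ hN
    have := mul_nonneg (sub_nonneg.2 hcN) hu
    linarith

/-- In the noncollinear case an `ε`-kernel can be refined to an `ε / 2`-kernel. -/
theorem exists_refinement_of_not_collinear {ε : ℝ} (hε : 0 < ε)
    (P K : Finset (EuclideanSpace ℝ (Fin 2))) (hK : IsEpsKernel ε P K)
    (hP : ∃ p ∈ P, ∃ q ∈ P, ∃ r ∈ P, planarDet (r - p) (q - p) ≠ 0) :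
    ∃ Q, IsEpsKernel (ε / 2) P Q ∧ Q.card ≤ 32 * K.card := by
  classical
  obtain ⟨p₀, hp₀, q₀, hq₀, r₀, hr₀, h₀⟩ := hP
  obtain ⟨⟨⟨a, b⟩, ⟨c, g⟩⟩, hmem, hmax⟩ := ((P ×ˢ P) ×ˢ (P ×ˢ P)).exists_max_image
    (fun z => |planarDet (z.1.1 - z.1.2) (z.2.1 - z.2.2)|)
    ⟨((p₀, p₀), (p₀, p₀)), by simp [hp₀]⟩
  simp only [Finset.mem_product] at hmem
  obtain ⟨⟨ha, hb⟩, hc, hg⟩ := hmem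
  have hmax' : ∀ p ∈ P, ∀ q ∈ P, ∀ r ∈ P, ∀ s ∈ P,
      |planarDet (p - q) (r - s)| ≤ |planarDet (a - b) (c - g)| := fun p hp q hq r hr s hs =>
    hmax ((p, q), (r, s)) (by simp [hp, hq, hr, hs])
  set x := a - b with hx
  set y := c - g with hy
  set D := planarDet x y with hD
  have hDpos : 0 < |D| := (abs_pos.2 h₀).trans_le (hmax' _ hr₀ _ hp₀ _ hq₀ _ hp₀)
  have hD0 : D ≠ 0 := abs_pos.1 hDpos
  have hDxy : D = x 0 * y 1 - x 1 * y 0 := rfl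
  -- The vectors `e, f` dual to `x, y`, by Cramer's rule; maximality of `|D|` bounds the widths
  -- along them by 1.
  have ie : ∀ z : EuclideanSpace ℝ (Fin 2),
      inner ℝ z (!₂[y 1 / D, -y 0 / D]) = planarDet z y / D := by
    intro z
    simp only [real_inner_fin_two, planarDet]
    simp
    ring
  have jf : ∀ z : EuclideanSpace ℝ (Fin 2),
      inner ℝ z (!₂[-x 1 / D, x 0 / D]) = planarDet x z / D := by
    intro z
    simp only [real_inner_fin_two, planarDet]
    simp
    ring
  have hself : ∀ z, planarDet z z = 0 := fun z => by unfold planarDet; ring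
  have hdiv : ∀ w, |w| ≤ |D| → w / D ≤ 1 := fun w hw =>
    (le_abs_self _).trans (by rw [abs_div]; exact (div_le_one hDpos).2 hw)
  refine exists_refinement_of_dual_pair hε P K hK !₂[y 1 / D, -y 0 / D] !₂[-x 1 / D, x 0 / D]
    (fun u => ⟨inner ℝ x u, inner ℝ y u, ?_⟩) (fun p hp q hq => ?_) (fun p hp q hq => ?_)
    ⟨a, ha, b, hb, ?_, ?_⟩ ⟨c, hc, g, hg, ?_, ?_⟩
  · ext i
    fin_cases i
    · simp [real_inner_fin_two]
      field_simp
      rw [hDxy]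
      ring
    · simp [real_inner_fin_two]
      field_simp
      rw [hDxy]
      ring
  · rw [ie]
    exact hdiv _ (hmax' p hp q hq c hc g hg)
  · rw [jf]
    exact hdiv _ (hmax' a ha b hb p hp q hq)
  · rw [ie]
    exact div_self hD0
  · rw [jf, ← hx, hself, zero_div]
  · rw [ie, ← hy, hself, zero_div]
  · rw [jf]
    exact div_self hD0

theorem mainTheorem3 :
    ∃ C : ℝ, ∀ (P : Finset (EuclideanSpace ℝ (Fin 2))), P.Nonempty → ∀ ε : ℝ, 0 < ε →
      0 < kappa P ε ∧ (kappa P (ε / 2) : ℝ) / (kappa P ε : ℝ) ≤ C := by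
  refine ⟨32, fun P hP ε hε => ?_⟩
  have hpos := kappa_pos hε.le hP
  refine ⟨hpos, ?_⟩
  rw [div_le_iff₀ (by exact_mod_cast hpos)]
  suffices h : kappa P (ε / 2) ≤ 32 * kappa P ε by exact_mod_cast h
  -- In the collinear case two points suffice, and `kappa P ε ≥ 1`.
  by_cases hcol : ∀ p ∈ P, ∀ q ∈ P, ∀ r ∈ P, planarDet (r - p) (q - p) = 0
  · obtain ⟨K, hK, hc⟩ := exists_isEpsKernel_card_le_two (half_pos hε).le P hP hcol
    have := hK.kappa_le
    omega
  · push Not at hcol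
    obtain ⟨K, hK, hc⟩ := exists_isEpsKernel_card_eq_kappa hε.le hP
    obtain ⟨Q, hQ, hQc⟩ := exists_refinement_of_not_collinear hε P K hK hcol
    exact hc ▸ hQ.kappa_le.trans hQc
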